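/- Let $X$ be an infinite set (of any cardinality) and let $H \le G$ be subgroups of $\mathrm{Sym}(X)$, both closed in $\mathrm{Sym}(X)$ in the topology of pointwise convergence, where $X$ carries the discrete topology. Suppose that $G$ and $H$ are orbit-equivalent, meaning that for every positive integer $k$ they have the same orbits on the collection of $k$-element subsets of $X$. Suppose further that $G$ is primitive (it is transitive on $X$ and preserves no equivalence relation on $X$ other than equality and the universal relation) but not $2$-transitive (it is not transitive on ordered pairs of distinct elements of $X$). Then $H = G$. -/

import Mathlib

/-- The topology of pointwise convergence on `Sym(X)`, where `X` is discrete: the topology induced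
from the product topology on `X → X`. -/
abbrev permPointwiseTopology (X : Type*) : TopologicalSpace (Equiv.Perm X) :=
  TopologicalSpace.induced (fun (g : Equiv.Perm X) (x : X) => g x)
    (@Pi.topologicalSpace X (fun _ => X) (fun _ => ⊥))

/-- A closed permutation group on `X`: a subgroup of `Sym(X)` that is closed in `Sym(X)` in the
topology of pointwise convergence. -/
def IsClosedPermGroup {X : Type*} (G : Subgroup (Equiv.Perm X)) : Prop :=
  @IsClosed (Equiv.Perm X) (permPointwiseTopology X) (G : Set (Equiv.Perm X))

open Classical in
/-- Two permutation groups on `X` are orbit-equivalent if, for every positive integer `k`, they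
have the same orbits on the collection of `k`-element subsets of `X`. -/
def OrbitEquivalent {X : Type*} (G H : Subgroup (Equiv.Perm X)) : Prop :=
  ∀ k : ℕ, 0 < k → ∀ A : Set.powersetCard X k, MulAction.orbit G A = MulAction.orbit H A

open Filter

/-! Let `A` be finite, and let `B` be a finite set whose setwise stabiliser in `G` fixes `A`
pointwise. Given `g` in `G`, orbit equivalence gives `h` in `H` with `h B = g B`; then `h⁻¹ g`
stabilises `B`, so `h` and `g` agree on `A`. If every `A` admits such a `B`, then `H` is dense in
`G`, hence equal to it (`eq_of_finitelyRigid`). It suffices to exclude the moves of `a` to `b` one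
pair at a time, as in `SeparatesPairs`.

To separate pairs, an orbital that is not all of the off-diagonal yields either an invariant
tournament or an invariant graph that is neither empty nor complete. Primitivity is used throughout
as a dichotomy: an invariant equivalence relation is equality or universal. When a suitable relation
of being "close" is universal, counting differences gives an invariant integer pseudometric, and
double counting or local finiteness makes it unbounded; one far point then separates `a` from `b`
(`separatesPairs_of_unbounded`). When it is equality, some nonprincipal ultrafilter tells `a` from
`b`, and finite sets of points generic for ultrafilters are added to `C` so that an automorphism of
the enlarged structure preserves both `C` and the type over the ultrafilter
(`exists_separating_of_tournament`, `exists_separating_of_indepUltrafilter`). -/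

/-- Every finite set of points is fixed pointwise by the setwise stabiliser of some finite set. -/
def FinitelyRigid (G X : Type*) [Group G] [MulAction G X] : Prop :=
  ∀ A : Finset X, ∃ B : Finset X, ∀ g : G, (∀ b ∈ B, g • b ∈ B) → ∀ a ∈ A, g • a = a

/-- For distinct points `a`, `b` of a finite set `C`, some finite set containing `C` has a setwise
stabiliser that preserves `C` and does not move `a` to `b`. -/
def SeparatesPairs (G X : Type*) [Group G] [MulAction G X] : Prop :=
  ∀ (C : Finset X) (a b : X), a ∈ C → b ∈ C → a ≠ b →
    ∃ B : Finset X, C ⊆ B ∧ ∀ g : G, (∀ c ∈ B, g • c ∈ B) → (∀ c ∈ C, g • c ∈ C) ∧ g • a ≠ b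

/-! ### Rigidity from pair separation; unbounded pseudometrics -/

section Action

variable {G X : Type*} [Group G] [MulAction G X]

theorem SeparatesPairs.finitelyRigid (h : SeparatesPairs G X) : FinitelyRigid G X := by
  classical
  intro A
  have key : ∀ L : Finset (X × X), L ⊆ A ×ˢ A → ∃ B : Finset X, A ⊆ B ∧
      ∀ g : G, (∀ b ∈ B, g • b ∈ B) → (∀ a ∈ A, g • a ∈ A) ∧
        ∀ p ∈ L, p.1 ≠ p.2 → g • p.1 ≠ p.2 := by
    intro L
    induction L using Finset.induction_on with
    | empty => exact fun _ => ⟨A, Finset.Subset.refl _, fun g hg => ⟨hg, by simp⟩⟩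
    | insert p L _ ih =>
      intro hL
      obtain ⟨B, hAB, hB⟩ := ih ((Finset.subset_insert _ _).trans hL)
      have hp := Finset.mem_product.1 (hL (Finset.mem_insert_self p L))
      by_cases hne : p.1 = p.2
      · refine ⟨B, hAB, fun g hg => ⟨(hB g hg).1, fun q hq hq' => ?_⟩⟩
        rcases Finset.mem_insert.1 hq with rfl | hq
        · exact absurd hne hq'
        · exact (hB g hg).2 q hq hq'
      -- Separation is applied to `B` rather than to `A`, so the stabiliser of `B'` preserves `B`
      -- and inherits every earlier exclusion.
      · obtain ⟨B', hBB', hB'⟩ := h B p.1 p.2 (hAB hp.1) (hAB hp.2) hne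
        refine ⟨B', hAB.trans hBB', fun g hg => ?_⟩
        obtain ⟨h1, h2⟩ := hB' g hg
        refine ⟨(hB g h1).1, fun q hq hq' => ?_⟩
        rcases Finset.mem_insert.1 hq with rfl | hq
        · exact h2
        · exact (hB g h1).2 q hq hq'
  obtain ⟨B, -, hB⟩ := key (A ×ˢ A) (Finset.Subset.refl _)
  refine ⟨B, fun g hg a ha => ?_⟩
  obtain ⟨h1, h2⟩ := hB g hg
  by_contra hne
  exact h2 (a, g • a) (Finset.mk_mem_product ha (h1 a ha)) (Ne.symm hne) rfl

theorem inv_smul_mem_of_forall_smul_mem {B : Finset X} {g : G} (hg : ∀ b ∈ B, g • b ∈ B) :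
    ∀ b ∈ B, g⁻¹ • b ∈ B := by
  classical
  intro b hb
  have : B.image (g • ·) = B := by
    apply Finset.eq_of_subset_of_card_le
    · intro x hx
      obtain ⟨y, hy, rfl⟩ := Finset.mem_image.1 hx
      exact hg y hy
    · rw [Finset.card_image_of_injective _ (MulAction.injective g)]
  rw [← this] at hb
  obtain ⟨y, hy, rfl⟩ := Finset.mem_image.1 hb
  simpa using hy

theorem card_filter_smul {B : Finset X} {g : G} (hg : ∀ b ∈ B, g • b ∈ B) (p q : X → Prop)
    [DecidablePred p] [DecidablePred q] (h : ∀ b ∈ B, p b ↔ q (g • b)) :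
    (B.filter p).card = (B.filter q).card := by
  classical
  refine Finset.card_bij (fun b _ => g • b) (fun b hb => ?_) (fun _ _ _ _ h => MulAction.injective g h)
    (fun b hb => ?_)
  · rw [Finset.mem_filter] at hb ⊢
    exact ⟨hg b hb.1, (h b hb.1).1 hb.2⟩
  · rw [Finset.mem_filter] at hb
    have := inv_smul_mem_of_forall_smul_mem hg b hb.1
    refine ⟨g⁻¹ • b, Finset.mem_filter.2 ⟨this, (h _ this).2 (by simpa using hb.2)⟩, by simp⟩

theorem eq_or_forall_of_isPreprimitive [MulAction.IsPreprimitive G X] {r : X → X → Prop}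
    (hr : Equivalence r) (hinv : ∀ (g : G) x y, r x y → r (g • x) (g • y)) :
    (∀ x y, r x y → x = y) ∨ ∀ x y, r x y := by
  by_cases h : ∀ x y, r x y → x = y
  · exact Or.inl h
  push Not at h
  obtain ⟨a, b, hab, hne⟩ := h
  have hblock : MulAction.IsBlock G {x | r a x} := by
    rw [MulAction.isBlock_iff_smul_eq_of_nonempty]
    rintro g ⟨x, hx1, hx2⟩
    obtain ⟨y, hy, rfl⟩ := hx1
    have hag : r a (g • a) := hr.trans hx2 (hr.symm (hinv g _ _ hy))
    ext z
    rw [Set.mem_smul_set_iff_inv_smul_mem]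
    constructor
    · intro hz
      have := hinv g _ _ hz
      rw [smul_inv_smul] at this
      exact hr.trans hag this
    · intro hz
      have := hinv g⁻¹ _ _ (hr.trans (hr.symm hag) hz)
      rwa [inv_smul_smul] at this
  rcases MulAction.IsPreprimitive.isTrivialBlock_of_isBlock hblock with h | h
  · exact absurd (h (hr.refl a) hab) hne
  · right
    have : ∀ x, r a x := fun x => by
      have : x ∈ {x | r a x} := h ▸ Set.mem_univ x
      exact this
    exact fun x y => hr.trans (hr.symm (this x)) (this y)

/-- Add to `C` one point `p` that is farther from every point of `C` than the diameter of `C`, with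
unequal distances to `a` and `b`. Its remoteness makes `p` fixed by the stabiliser of `C ∪ {p}`, and
the unequal distances then forbid `a ↦ b`. -/
theorem separatesPairs_of_unbounded [MulAction.IsPreprimitive G X] (ρ : X → X → ℕ)
    (hself : ∀ x, ρ x x = 0)
    (htri : ∀ x y z, ρ x z ≤ ρ x y + ρ y z) (hinv : ∀ (g : G) x y, ρ (g • x) (g • y) = ρ x y)
    (hunb : ∀ R, ∃ x y, R < ρ x y) : SeparatesPairs G X := by
  classical
  have far : ∀ R a b, a ≠ b → ∃ p, (R < ρ p a ∨ R < ρ p b) ∧ ρ p a ≠ ρ p b := by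
    intro R a b hab
    by_contra hcon
    push Not at hcon
    -- No far point distinguishes `x` from `y`. Were this universal, the point `x` itself would
    -- contradict it as soon as `ρ x y` exceeds `R`.
    let r : X → X → Prop := fun x y => ∀ p, (R < ρ p x ∨ R < ρ p y) → ρ p x = ρ p y
    have hr : Equivalence r := by
      refine ⟨fun _ _ _ => rfl, fun h p hp => (h p hp.symm).symm, fun {x y z} h1 h2 p hp => ?_⟩
      rcases hp with hp | hp
      · have := h1 p (Or.inl hp)
        rw [this]
        exact h2 p (Or.inl (this ▸ hp))
      · have := h2 p (Or.inr hp)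
        rw [← this]
        exact h1 p (Or.inr (this ▸ hp))
    have hri : ∀ (g : G) x y, r x y → r (g • x) (g • y) := by
      intro g x y h p
      have := h (g⁻¹ • p)
      rw [← hinv g, smul_inv_smul, ← hinv g (g⁻¹ • p) y, smul_inv_smul] at this
      exact this
    rcases eq_or_forall_of_isPreprimitive hr hri with h | h
    · exact hab (h a b hcon)
    · obtain ⟨x, y, hxy⟩ := hunb R
      have := h x y x (Or.inr hxy)
      rw [hself] at this
      omega
  intro C a b ha hb hab
  obtain ⟨D, hD⟩ : ∃ D, ∀ x ∈ C, ∀ y ∈ C, ρ x y ≤ D :=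
    ⟨(C ×ˢ C).sup fun q => ρ q.1 q.2, fun x hx y hy =>
      Finset.le_sup (f := fun q : X × X => ρ q.1 q.2) (Finset.mk_mem_product hx hy)⟩
  obtain ⟨p, hp1, hp2⟩ := far (2 * D) a b hab
  have hpC : ∀ c ∈ C, D < ρ p c := by
    intro c hc
    have h1 := htri p c a
    have h2 := htri p c b
    have h3 := hD c hc a ha
    have h4 := hD c hc b hb
    omega
  have hfix : ∀ g : G, (∀ c ∈ insert p C, g • c ∈ insert p C) → g • p = p := by
    intro g hg
    by_contra hne
    have hgp : g • p ∈ C := (Finset.mem_insert.1 (hg p (Finset.mem_insert_self _ _))).resolve_left hne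
    obtain ⟨c, hc, hcp⟩ : ∃ c ∈ C, c ≠ g • p := by
      by_cases h : a = g • p
      · exact ⟨b, hb, fun h' => hab (h.trans h'.symm)⟩
      · exact ⟨a, ha, h⟩
    have h1 := inv_smul_mem_of_forall_smul_mem hg c (Finset.mem_insert_of_mem hc)
    have h2 : g⁻¹ • c ∈ C := (Finset.mem_insert.1 h1).resolve_left
      fun h => hcp (by rw [← h, smul_inv_smul])
    have h3 := hpC _ h2
    rw [← hinv g, smul_inv_smul] at h3
    have := hD _ hgp c hc
    omega
  refine ⟨insert p C, Finset.subset_insert _ _, fun g hg => ?_⟩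
  have hgp := hfix g hg
  refine ⟨fun c hc => ?_, fun h => ?_⟩
  · refine (Finset.mem_insert.1 (hg c (Finset.mem_insert_of_mem hc))).resolve_left fun h => ?_
    have : c = p := MulAction.injective g (h.trans hgp.symm)
    have h1 := hpC c hc
    rw [this, hself] at h1
    omega
  · apply hp2
    rw [← h, ← hinv g p a, hgp]

end Action

/-! ### Double counting for relations with uniformly close rows -/

section Counting

variable {X : Type*}

theorem Set.ncard_setOf_not_iff_trans_le (p q r : X → Prop) (h1 : {w | ¬(p w ↔ q w)}.Finite)
    (h2 : {w | ¬(q w ↔ r w)}.Finite) :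
    {w | ¬(p w ↔ r w)}.Finite ∧
      {w | ¬(p w ↔ r w)}.ncard ≤ {w | ¬(p w ↔ q w)}.ncard + {w | ¬(q w ↔ r w)}.ncard := by
  have hsub : {w | ¬(p w ↔ r w)} ⊆ {w | ¬(p w ↔ q w)} ∪ {w | ¬(q w ↔ r w)} := by
    intro w hw
    simp only [Set.mem_union, Set.mem_ofPred_eq] at hw ⊢
    tauto
  exact ⟨(h1.union h2).subset hsub,
    (Set.ncard_le_ncard hsub (h1.union h2)).trans (Set.ncard_union_le _ _)⟩

open Classical in
theorem card_filter_le_ncard_setOf_not_iff {p q : X → Prop} {F : Finset X}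
    (hfin : {w | ¬(p w ↔ q w)}.Finite) (hq : ∀ w ∈ F, ¬ q w) :
    (F.filter p).card ≤ {w | ¬(p w ↔ q w)}.ncard := by
  rw [← Set.ncard_coe_finset]
  refine Set.ncard_le_ncard (fun w hw => ?_) hfin
  simp only [Finset.coe_filter, Set.mem_ofPred_eq] at hw ⊢
  have := hq w hw.1
  tauto

open Classical in
theorem card_le_card_filter_add_ncard_setOf_not_iff {p q : X → Prop} {F : Finset X}
    (hfin : {w | ¬(p w ↔ q w)}.Finite) (hq : ∀ w ∈ F, q w) :
    F.card ≤ (F.filter p).card + {w | ¬(p w ↔ q w)}.ncard := by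
  rw [← Finset.card_filter_add_card_filter_not p]
  gcongr
  rw [← Set.ncard_coe_finset]
  refine Set.ncard_le_ncard (fun w hw => ?_) hfin
  simp only [Finset.coe_filter, Set.mem_ofPred_eq] at hw ⊢
  have := hq w hw.1
  tauto

/-- If all rows and columns of a relation are uniformly close, each row is finite or cofinite. -/
theorem finite_or_finite_compl_of_forall_ncard_le (T : X → X → Prop) (m : ℕ)
    (hfin : ∀ y v, {w | ¬(T w y ↔ T v w)}.Finite)
    (hcard : ∀ y v, {w | ¬(T w y ↔ T v w)}.ncard ≤ m) (v : X) :
    {w | T v w}.Finite ∨ {w | ¬ T v w}.Finite := by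
  classical
  by_contra hcon
  push Not at hcon
  -- Between `F1` and `F2` each column has at most `m` related pairs. A row differs from row `v` in
  -- at most `2 * m` places, through column `v`, so it has at least `m + 1`. With both sets of size
  -- `3 * m + 1` the two counts clash.
  obtain ⟨F1, hF1, hc1⟩ := Set.Infinite.exists_subset_card_eq hcon.1 (3 * m + 1)
  obtain ⟨F2, hF2, hc2⟩ := Set.Infinite.exists_subset_card_eq hcon.2 (3 * m + 1)
  have hcol : ∀ y ∈ F1, (F2.filter fun w => T w y).card ≤ m := fun y _ =>
    (card_filter_le_ncard_setOf_not_iff (hfin y v) fun w hw => hF2 hw).trans (hcard y v)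
  have hrow : ∀ w ∈ F2, m + 1 ≤ (F1.filter fun y => T w y).card := by
    intro w _
    have hflip : {u | ¬(T w u ↔ T u v)} = {u | ¬(T u v ↔ T w u)} := by
      ext u; simp only [Set.mem_ofPred_eq]; tauto
    have h := Set.ncard_setOf_not_iff_trans_le (fun u => T w u) (fun u => T u v) (fun u => T v u)
      (hflip ▸ hfin v w) (hfin v v)
    have h1 : F1.card ≤ (F1.filter fun y => T w y).card + _ :=
      card_le_card_filter_add_ncard_setOf_not_iff h.1 fun y hy => hF1 hy
    have h2 := hcard v w
    have h3 := hcard v v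
    have h4 := h.2
    rw [hflip] at h4
    omega
  have hdc := Finset.sum_card_bipartiteAbove_eq_sum_card_bipartiteBelow (s := F1) (t := F2)
    (fun y w => T w y)
  have h1 : ∑ y ∈ F1, (F2.filter fun w => T w y).card ≤ F1.card * m :=
    Finset.sum_le_card_nsmul _ _ _ hcol
  have h2 : F2.card * (m + 1) ≤ ∑ w ∈ F2, (F1.filter fun y => T w y).card :=
    Finset.card_nsmul_le_sum _ _ _ hrow
  simp only [Finset.bipartiteAbove, Finset.bipartiteBelow] at hdc
  rw [hc1] at h1
  rw [hc2] at h2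
  nlinarith

/-- On an infinite set, the out-neighbourhoods of a tournament cannot be uniformly close. -/
theorem not_forall_ncard_le_of_tournament [Infinite X] (T : X → X → Prop)
    (htot : ∀ x y, x ≠ y → (T x y ↔ ¬ T y x)) (hirr : ∀ x, ¬ T x x) (m : ℕ)
    (hfin : ∀ x y, {w | ¬(T x w ↔ T y w)}.Finite)
    (hcard : ∀ x y, {w | ¬(T x w ↔ T y w)}.ncard ≤ m) : False := by
  classical
  obtain ⟨v⟩ : Nonempty X := inferInstance
  have hsum : ∀ F : Finset X, 2 * ∑ x ∈ F, (F.filter fun y => T x y).card = F.card * (F.card - 1) := by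
    intro F
    have hdc := Finset.sum_card_bipartiteAbove_eq_sum_card_bipartiteBelow (s := F) (t := F) T
    simp only [Finset.bipartiteAbove, Finset.bipartiteBelow] at hdc
    rw [two_mul]
    nth_rewrite 2 [hdc]
    rw [← Finset.sum_add_distrib, ← smul_eq_mul, ← Finset.sum_const]
    refine Finset.sum_congr rfl fun x hx => ?_
    rw [← Finset.card_erase_of_mem hx, ← Finset.card_union_of_disjoint]
    · congr 1
      ext y
      simp only [Finset.mem_union, Finset.mem_filter, Finset.mem_erase]
      have := htot x y
      have := hirr x
      by_cases hxy : x = y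
      · subst hxy; tauto
      · have : y ≠ x := Ne.symm hxy
        tauto
    · rw [Finset.disjoint_filter]
      intro y _ h1 h2
      by_cases hxy : x = y
      · subst hxy; exact hirr x h1
      · exact (htot x y hxy).1 h1 h2
  by_cases hinf : {w | T v w}.Infinite
  -- A tournament on `2 * m + 2` points has mean out-degree `m + 1/2`; closeness to row `v` forces
  -- all out-degrees to be at least `m + 2` here, and at most `m` in the other case.
  · obtain ⟨F, hF, hc⟩ := hinf.exists_subset_card_eq (2 * m + 2)
    have h1 : ∀ x ∈ F, m + 2 ≤ (F.filter fun y => T x y).card := by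
      intro x _
      have h1 : F.card ≤ (F.filter fun y => T x y).card + _ :=
        card_le_card_filter_add_ncard_setOf_not_iff (hfin x v) fun y hy => hF hy
      have := hcard x v
      omega
    have h2 := Finset.card_nsmul_le_sum _ _ _ h1
    have h3 := hsum F
    rw [hc] at h2 h3
    simp only [smul_eq_mul] at h2
    have : 2 * m + 2 - 1 = 2 * m + 1 := by omega
    rw [this] at h3
    nlinarith
  · have hinf : {w | ¬ T v w}.Infinite := by
      have := (Set.not_infinite.1 hinf).infinite_compl
      exact this
    obtain ⟨F, hF, hc⟩ := hinf.exists_subset_card_eq (2 * m + 2)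
    have h1 : ∀ x ∈ F, (F.filter fun y => T x y).card ≤ m := fun x _ =>
      (card_filter_le_ncard_setOf_not_iff (hfin x v) fun y hy => hF hy).trans (hcard x v)
    have h2 := Finset.sum_le_card_nsmul _ _ _ h1
    have h3 := hsum F
    rw [hc] at h2 h3
    simp only [smul_eq_mul] at h2
    have : 2 * m + 2 - 1 = 2 * m + 1 := by omega
    rw [this] at h3
    nlinarith

end Counting

/-! ### Pseudometrics from symmetric differences and from locally finite graphs -/

section Action

variable {G X : Type*} [Group G] [MulAction G X] [MulAction.IsPreprimitive G X]

theorem separatesPairs_of_ncard_unbounded (T : X → X → Prop)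
    (hinv : ∀ (g : G) x y, T (g • x) (g • y) ↔ T x y)
    (hfin : ∀ x y, {w | ¬(T x w ↔ T y w)}.Finite)
    (hunb : ∀ m, ∃ x y, m < {w | ¬(T x w ↔ T y w)}.ncard) : SeparatesPairs G X := by
  refine separatesPairs_of_unbounded (fun x y => {w | ¬(T x w ↔ T y w)}.ncard) (by simp)
    (fun x y z => (Set.ncard_setOf_not_iff_trans_le _ _ _ (hfin x y) (hfin y z)).2) ?_ hunb
  intro g x y
  have : {w | ¬(T (g • x) w ↔ T (g • y) w)} = (g • ·) '' {w | ¬(T x w ↔ T y w)} := by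
    ext w
    constructor
    · intro hw
      refine ⟨g⁻¹ • w, ?_, by simp⟩
      rw [Set.mem_ofPred_eq, ← hinv g x, ← hinv g y, smul_inv_smul]
      exact hw
    · rintro ⟨w, hw, rfl⟩
      simpa only [Set.mem_ofPred_eq, hinv] using hw
  simp only [this]
  exact Set.ncard_image_of_injective _ (MulAction.injective g)

/-- The graph metric of a nonempty locally finite invariant graph is unbounded. -/
theorem separatesPairs_of_locallyFinite [Infinite X] (E : X → X → Prop) (hsymm : ∀ x y, E x y → E y x)
    (hirr : ∀ x, ¬ E x x) (hinv : ∀ (g : G) x y, E (g • x) (g • y) ↔ E x y) (hne : ∃ x y, E x y)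
    (hfin : ∀ x, {y | E x y}.Finite) : SeparatesPairs G X := by
  let Γ : SimpleGraph X := ⟨E, ⟨hsymm⟩, ⟨hirr⟩⟩
  let φ : G → (Γ ≃g Γ) := fun g => ⟨MulAction.toPerm g, fun {x y} => hinv g x y⟩
  -- Reachability is an invariant equivalence relation and there is an edge, so primitivity makes it
  -- universal.
  have hconn : Γ.Connected := by
    rcases eq_or_forall_of_isPreprimitive (G := G) (r := Γ.Reachable)
      ⟨fun x => .refl x, fun h => h.symm, fun h1 h2 => h1.trans h2⟩
      (fun g x y h => h.map (φ g).toHom) with h | h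
    · obtain ⟨x, y, hxy⟩ := hne
      have := h x y (SimpleGraph.Adj.reachable hxy)
      subst this
      exact absurd hxy (hirr x)
    · exact { preconnected := h, nonempty := inferInstance }
  refine separatesPairs_of_unbounded Γ.dist (fun x => SimpleGraph.dist_self)
    (fun x y z => hconn.dist_triangle) ?_ ?_
  · have hle : ∀ (g : G) x y, Γ.dist (g • x) (g • y) ≤ Γ.dist x y := by
      intro g x y
      obtain ⟨p, hp⟩ := hconn.exists_walk_length_eq_dist x y
      rw [← hp, ← SimpleGraph.Walk.length_map (φ g).toHom p]
      exact SimpleGraph.dist_le _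
    intro g x y
    refine le_antisymm (hle g x y) ?_
    simpa using hle g⁻¹ (g • x) (g • y)
  · intro R
    obtain ⟨x⟩ : Nonempty X := inferInstance
    have hball : ∀ n, {y | Γ.dist x y ≤ n}.Finite := by
      intro n
      induction n with
      | zero =>
        refine (Set.finite_singleton x).subset fun y hy => ?_
        have : Γ.dist x y = 0 := Nat.le_zero.1 hy
        exact ((hconn.dist_eq_zero_iff).1 this).symm
      | succ n ih =>
        refine (ih.union (ih.biUnion fun z _ => hfin z)).subset fun y hy => ?_
        by_cases hxy : x = y
        · subst hxy
          exact Or.inl (by simp)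
        obtain ⟨p, hp⟩ := hconn.exists_walk_length_eq_dist y x
        cases p with
        | nil => exact absurd rfl hxy
        | @cons _ z _ hyz p =>
          right
          simp only [Set.mem_iUnion, Set.mem_ofPred_eq]
          refine ⟨z, ?_, hsymm _ _ hyz⟩
          have h1 := SimpleGraph.dist_le p
          have h2 : Γ.dist x y ≤ n + 1 := hy
          rw [SimpleGraph.Walk.length_cons, SimpleGraph.dist_comm] at hp
          rw [SimpleGraph.dist_comm]
          omega
    obtain ⟨y, hy⟩ := (hball R).infinite_compl.nonempty
    exact ⟨x, y, not_le.1 hy⟩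

end Action

/-! ### Points generic for an ultrafilter -/

section Generic

variable {X : Type*}

theorem Ultrafilter.eventually_iff_eventually (U : Ultrafilter X) (p : X → Prop) :
    ∀ᶠ s in (U : Filter X), (p s ↔ ∀ᶠ u in (U : Filter X), p u) := by
  by_cases h : ∀ᶠ u in (U : Filter X), p u
  · filter_upwards [h] with s hs
    exact iff_of_true hs h
  · filter_upwards [Ultrafilter.eventually_not.2 h] with s hs
    exact iff_of_false hs h

theorem Ultrafilter.eventually_generic (U : Ultrafilter X) (hU : (U : Filter X) ≤ cofinite)
    (E : X → X → Prop) (D : Finset X) :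
    ∀ᶠ s in (U : Filter X), s ∉ D ∧ ∀ d ∈ D, (E d s ↔ ∀ᶠ u in (U : Filter X), E d u) := by
  refine Filter.Eventually.and (hU D.finite_toSet.compl_mem_cofinite) ?_
  rw [Filter.eventually_all_finset]
  exact fun d _ => U.eventually_iff_eventually (E d)

theorem Ultrafilter.exists_finset_card_eq (U : Ultrafilter X) (hU : (U : Filter X) ≤ cofinite)
    {p : X → Prop} (hp : ∀ᶠ u in (U : Filter X), p u) (n : ℕ) :
    ∃ S : Finset X, S.card = n ∧ ∀ s ∈ S, p s := by
  have hinf : {u | p u}.Infinite := fun hfin =>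
    Ultrafilter.compl_notMem_iff.2 hp (hU hfin.compl_mem_cofinite)
  obtain ⟨S, hS, hc⟩ := hinf.exists_subset_card_eq n
  exact ⟨S, hc, fun s hs => hS hs⟩

theorem Set.Infinite.exists_ultrafilter {s : Set X} (hs : s.Infinite) :
    ∃ U : Ultrafilter X, (U : Filter X) ≤ cofinite ∧ s ∈ U := by
  have : (cofinite ⊓ 𝓟 s).NeBot := cofinite_inf_principal_neBot_iff.2 hs
  refine ⟨Ultrafilter.of (cofinite ⊓ 𝓟 s), (Ultrafilter.of_le _).trans inf_le_left, ?_⟩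
  exact le_principal_iff.1 ((Ultrafilter.of_le _).trans inf_le_right)

theorem Ultrafilter.not_iff_of_eventually_not_iff (U : Ultrafilter X) {p q : X → Prop}
    (h : ∀ᶠ u in (U : Filter X), ¬(p u ↔ q u)) :
    ¬((∀ᶠ u in (U : Filter X), p u) ↔ ∀ᶠ u in (U : Filter X), q u) := by
  obtain ⟨u, h1, h2, h3⟩ :=
    (h.and ((U.eventually_iff_eventually p).and (U.eventually_iff_eventually q))).exists
  rwa [h2, h3] at h1

end Generic

/-! ### Tournaments -/

section Tournament

variable {G X : Type*} [Group G] [MulAction G X]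

/-- Extend `C` by generic points in the pattern `P → s → Q`, with `P` and `Q` of the size of `C`.
The out-degree of `s` is unique in `B`, so `s` is fixed. Degrees among the points before `s` tell
`C` from `P`, and those among the points after `s` tell `C` from `Q`. Finally `T c s` records the
type `K c`, which differs at `a` and `b`. -/
theorem exists_separating_of_tournament (T : X → X → Prop)
    (hinv : ∀ (g : G) x y, T (g • x) (g • y) ↔ T x y)
    (htot : ∀ x y, x ≠ y → (T x y ↔ ¬ T y x)) (hirr : ∀ x, ¬ T x x) (C : Finset X) {a b : X}
    (ha : a ∈ C) (U : Ultrafilter X) (hU : (U : Filter X) ≤ cofinite)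
    (hasc : ∀ᶠ s in (U : Filter X), ∀ᶠ t in (U : Filter X), T s t)
    (hsep : ¬((∀ᶠ u in (U : Filter X), T a u) ↔ ∀ᶠ u in (U : Filter X), T b u)) :
    ∃ B : Finset X, C ⊆ B ∧
      ∀ g : G, (∀ c ∈ B, g • c ∈ B) → (∀ c ∈ C, g • c ∈ C) ∧ g • a ≠ b := by
  classical
  set K : X → Prop := fun c => ∀ᶠ u in (U : Filter X), T c u with hK
  have hasymm : ∀ x y, T x y → ¬ T y x := by
    intro x y h
    by_cases hxy : x = y
    · subst hxy; exact hirr x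
    · exact (htot x y hxy).1 h
  have hflip : ∀ x y, x ≠ y → ¬ T x y → T y x := fun x y hxy h => (htot y x hxy.symm).2 h
  obtain ⟨P, hPc, hP⟩ := U.exists_finset_card_eq hU (hasc.and (U.eventually_generic hU T C)) C.card
  obtain ⟨s, hsK, hsn, hsT⟩ := (hasc.and (U.eventually_generic hU T (C ∪ P))).exists
  obtain ⟨Q, hQc, hQ⟩ := U.exists_finset_card_eq hU
    (U.eventually_generic hU T (insert s (C ∪ P))) C.card
  have hPK : ∀ x ∈ P, K x := fun x hx => (hP x hx).1
  have hPC : ∀ x ∈ P, x ∉ C := fun x hx => (hP x hx).2.1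
  have hCP : ∀ c ∈ C, ∀ x ∈ P, (T c x ↔ K c) := fun c hc x hx => (hP x hx).2.2 c hc
  have hsC : s ∉ C := fun h => hsn (Finset.mem_union_left _ h)
  have hsP : s ∉ P := fun h => hsn (Finset.mem_union_right _ h)
  have hCs : ∀ c ∈ C, (T c s ↔ K c) := fun c hc => hsT c (Finset.mem_union_left _ hc)
  have hPs : ∀ x ∈ P, T x s := fun x hx => (hsT x (Finset.mem_union_right _ hx)).2 (hPK x hx)
  have hQC : ∀ y ∈ Q, y ∉ C := fun y hy h => (hQ y hy).1 (by simp [h])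
  have hQP : ∀ y ∈ Q, y ∉ P := fun y hy h => (hQ y hy).1 (by simp [h])
  have hQs : ∀ y ∈ Q, y ≠ s := fun y hy h => (hQ y hy).1 (by simp [h])
  have hCQ : ∀ c ∈ C, ∀ y ∈ Q, (T c y ↔ K c) := fun c hc y hy => (hQ y hy).2 c (by simp [hc])
  have hPQ : ∀ x ∈ P, ∀ y ∈ Q, T x y := fun x hx y hy =>
    ((hQ y hy).2 x (by simp [hx])).2 (hPK x hx)
  have hsQ : ∀ y ∈ Q, T s y := fun y hy => ((hQ y hy).2 s (by simp)).2 hsK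
  clear hP hQ hsT hsn
  set B := insert s (C ∪ P ∪ Q) with hB
  have hmem : ∀ x, x ∈ B ↔ x = s ∨ x ∈ C ∨ x ∈ P ∨ x ∈ Q := by
    intro x; simp [hB]
  set C₀ := C.filter fun c => ¬ K c with hC₀
  have hC₀Q : Disjoint C₀ Q := Finset.disjoint_left.2 fun x hx hx' =>
    hQC x hx' (Finset.mem_filter.1 hx).1
  have hsC₀Q : s ∉ C₀ ∪ Q := by
    rw [Finset.mem_union, not_or]
    exact ⟨fun h => hsC (Finset.mem_filter.1 h).1, fun h => hQs s h rfl⟩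
  have hC₀le : C₀.card ≤ C.card := Finset.card_filter_le _ _
  have hCpos : 0 < C.card := Finset.card_pos.2 ⟨a, ha⟩
  have hscore : (B.filter fun x => T s x).card = C₀.card + C.card := by
    rw [← hQc, ← Finset.card_union_of_disjoint hC₀Q]
    congr 1
    ext x
    simp only [Finset.mem_filter, hmem, Finset.mem_union, hC₀]
    grind
  have hscore' : ∀ x ∈ B, x ≠ s → (B.filter fun y => T x y).card ≠ C₀.card + C.card := by
    intro x hx hxs
    rcases (hmem x).1 hx with rfl | hx | hx | hx
    · exact absurd rfl hxs
    · by_cases hKx : K x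
      · apply ne_of_gt
        have : P ∪ Q ∪ {s} ⊆ B.filter fun y => T x y := by
          intro y
          simp only [Finset.mem_filter, hmem, Finset.mem_union, Finset.mem_singleton]
          grind
        have h2 := Finset.card_le_card this
        rw [Finset.card_union_of_disjoint, Finset.card_union_of_disjoint, hPc, hQc,
          Finset.card_singleton] at h2
        · omega
        · exact Finset.disjoint_left.2 fun y hy hy' => hQP y hy' hy
        · rw [Finset.disjoint_singleton_right]
          grind
      · apply ne_of_lt
        have : (B.filter fun y => T x y) ⊆ C.erase x := by
          intro y
          simp only [Finset.mem_filter, hmem, Finset.mem_erase]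
          grind
        have h2 := Finset.card_le_card this
        rw [Finset.card_erase_of_mem hx] at h2
        omega
    · apply ne_of_gt
      have : insert s (C₀ ∪ Q) ⊆ B.filter fun y => T x y := by
        intro y
        simp only [Finset.mem_filter, hmem, Finset.mem_union, Finset.mem_insert, hC₀]
        grind
      have h2 := Finset.card_le_card this
      rw [Finset.card_insert_of_notMem hsC₀Q, Finset.card_union_of_disjoint hC₀Q, hQc] at h2
      omega
    · apply ne_of_lt
      have : (B.filter fun y => T x y) ⊆ C₀ ∪ Q.erase x := by
        intro y
        simp only [Finset.mem_filter, hmem, Finset.mem_erase, Finset.mem_union, hC₀]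
        grind
      have h2 := (Finset.card_le_card this).trans (Finset.card_union_le _ _)
      rw [Finset.card_erase_of_mem hx] at h2
      omega
  refine ⟨B, fun c hc => (hmem c).2 (by simp [hc]), fun g hg => ?_⟩
  have hgs : g • s = s := by
    by_contra hne
    refine hscore' (g • s) (hg s ((hmem s).2 (by simp))) hne ?_
    rw [← hscore]
    exact (card_filter_smul hg _ _ fun x _ => (hinv g s x).symm).symm
  have hTs : ∀ x, T (g • x) s ↔ T x s := fun x => by rw [← hinv g x s, hgs]
  have hsT : ∀ x, T s (g • x) ↔ T s x := fun x => by rw [← hinv g s x, hgs]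
  have key : ∀ c ∈ C, g • c ∈ C ∧ (K (g • c) ↔ K c) := by
    intro c hc
    have hgc := hg c ((hmem c).2 (by simp [hc]))
    suffices h : g • c ∈ C by
      refine ⟨h, ?_⟩
      rw [← hCs _ h, hTs, hCs c hc]
    by_cases hKc : K c
    -- Among the points that beat `s`, this `c` beats all of `P`, whereas a point of `P` beats at
    -- most the rest of `P`.
    · have h1 : P ⊆ B.filter fun x => T x s ∧ T c x := by
        intro y
        simp only [Finset.mem_filter, hmem]
        grind
      have h2 := Finset.card_le_card h1
      rw [card_filter_smul hg _ (fun x => T x s ∧ T (g • c) x) fun x _ => by rw [hTs, hinv]] at h2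
      have h3 := (hTs c).2 ((hCs c hc).2 hKc)
      rcases (hmem _).1 hgc with h | h | h | h
      · exact absurd (h ▸ h3) (hirr _)
      · exact h
      · exfalso
        have : (B.filter fun x => T x s ∧ T (g • c) x) ⊆ P.erase (g • c) := by
          intro y
          simp only [Finset.mem_filter, hmem, Finset.mem_erase]
          grind
        have h4 := h2.trans (Finset.card_le_card this)
        rw [Finset.card_erase_of_mem h] at h4
        omega
      · exact absurd h3 (hasymm _ _ (hsQ _ h))
    · have h1 : Q ⊆ B.filter fun x => T s x ∧ T x c := by
        intro y
        simp only [Finset.mem_filter, hmem]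
        grind
      have h2 := Finset.card_le_card h1
      rw [card_filter_smul hg _ (fun x => T s x ∧ T x (g • c)) fun x _ => by rw [hsT, hinv]] at h2
      have h3 : T s (g • c) := (hsT c).2 (hflip c s (by grind) (by rwa [hCs c hc]))
      rcases (hmem _).1 hgc with h | h | h | h
      · exact absurd (h ▸ h3) (hirr _)
      · exact h
      · exact absurd h3 (hasymm _ _ (hPs _ h))
      · exfalso
        have : (B.filter fun x => T s x ∧ T x (g • c)) ⊆ Q.erase (g • c) := by
          intro y
          simp only [Finset.mem_filter, hmem, Finset.mem_erase]
          grind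
        have h4 := h2.trans (Finset.card_le_card this)
        rw [Finset.card_erase_of_mem h] at h4
        omega
  refine ⟨fun c hc => (key c hc).1, fun h => hsep ?_⟩
  exact h ▸ (key a ha).2.symm

theorem separatesPairs_of_tournament [Infinite X] [MulAction.IsPreprimitive G X]
    (T : X → X → Prop) (hinv : ∀ (g : G) x y, T (g • x) (g • y) ↔ T x y)
    (htot : ∀ x y, x ≠ y → (T x y ↔ ¬ T y x)) (hirr : ∀ x, ¬ T x x) : SeparatesPairs G X := by
  rcases eq_or_forall_of_isPreprimitive (G := G) (r := fun x y => {w | ¬(T x w ↔ T y w)}.Finite)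
    ⟨fun x => by simp, fun {x y} h => by simpa only [iff_comm] using h,
      fun {x y z} h1 h2 => (Set.ncard_setOf_not_iff_trans_le _ _ _ h1 h2).1⟩
    (fun g x y h => (h.image (g • ·)).subset fun w hw => ⟨g⁻¹ • w, by
      rwa [Set.mem_ofPred_eq, ← hinv g x, ← hinv g y, smul_inv_smul], by simp⟩) with h | h
  · intro C a b ha hb hab
    have hinf : {w | ¬(T a w ↔ T b w)}.Infinite := fun hfin => hab (h a b hfin)
    obtain ⟨U, hU, hUs⟩ := hinf.exists_ultrafilter
    have hsep := U.not_iff_of_eventually_not_iff hUs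
    by_cases hasc : ∀ᶠ s in (U : Filter X), ∀ᶠ t in (U : Filter X), T s t
    · exact exists_separating_of_tournament T hinv htot hirr C ha U hU hasc hsep
    -- If the ultrafilter is not ascending for `T`, it is ascending for the reversed tournament.
    · have hswap : ∀ x, (∀ᶠ t in (U : Filter X), T t x) ↔ ¬ ∀ᶠ t in (U : Filter X), T x t := by
        intro x
        rw [← Ultrafilter.eventually_not]
        have hne : ∀ᶠ t in (U : Filter X), t ≠ x := hU (Set.finite_singleton x).compl_mem_cofinite
        exact eventually_congr (hne.mono fun t ht => htot t x ht)
      refine exists_separating_of_tournament (fun x y => T y x) (fun g x y => hinv g y x)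
        (fun x y hxy => htot y x hxy.symm) hirr C ha U hU ?_ ?_
      · rw [← Ultrafilter.eventually_not] at hasc
        exact hasc.mono fun s hs => (hswap s).2 hs
      · rw [hswap, hswap]
        tauto
  · refine separatesPairs_of_ncard_unbounded T hinv h fun m => ?_
    by_contra hcon
    exact not_forall_ncard_le_of_tournament T htot hirr m h fun x y =>
      not_lt.1 fun hlt => hcon ⟨x, y, hlt⟩

end Tournament

/-! ### Independent ultrafilters and blow-ups by twin classes -/

/-- A nonprincipal ultrafilter whose generic finite subsets are independent in the graph `E`. -/
def IsIndepUltrafilter {X : Type*} (E : X → X → Prop) (U : Ultrafilter X) : Prop :=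
  (U : Filter X) ≤ cofinite ∧ ∀ᶠ s in (U : Filter X), ¬ ∀ᶠ t in (U : Filter X), E s t

section BlowUp

variable {X : Type*} {E : X → X → Prop}

theorem IsIndepUltrafilter.exists_finset (hsymm : ∀ x y, E x y → E y x) (hirr : ∀ x, ¬ E x x)
    {U : Ultrafilter X} (hU : IsIndepUltrafilter E U) {p : X → Prop}
    (hp : ∀ᶠ u in (U : Filter X), p u) (D : Finset X) (n : ℕ) :
    ∃ S : Finset X, S.card = n ∧ (∀ s ∈ S, p s) ∧ (∀ s ∈ S, s ∉ D) ∧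
      (∀ d ∈ D, ∀ s ∈ S, (E d s ↔ ∀ᶠ u in (U : Filter X), E d u)) ∧
      ∀ s ∈ S, ∀ t ∈ S, ¬ E s t := by
  classical
  -- The induction also needs each chosen point to be non-adjacent to the generic point of `U`, so
  -- that later points avoid it.
  suffices h : ∃ S : Finset X, S.card = n ∧ (∀ s ∈ S, ¬ ∀ᶠ t in (U : Filter X), E s t) ∧
      (∀ s ∈ S, p s) ∧ (∀ s ∈ S, s ∉ D) ∧
      (∀ d ∈ D, ∀ s ∈ S, (E d s ↔ ∀ᶠ u in (U : Filter X), E d u)) ∧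
      ∀ s ∈ S, ∀ t ∈ S, ¬ E s t by
    obtain ⟨S, h1, -, h2⟩ := h
    exact ⟨S, h1, h2⟩
  induction n with
  | zero => exact ⟨∅, by simp⟩
  | succ n ih =>
    obtain ⟨S, hc, hS, hSp, hSD, hDS, hind⟩ := ih
    obtain ⟨s, hs, hps, hsn, hsE⟩ :=
      (hU.2.and (hp.and (U.eventually_generic hU.1 E (D ∪ S)))).exists
    have hsS : ∀ t ∈ S, ¬ E t s := fun t ht h =>
      hS t ht ((hsE t (Finset.mem_union_right _ ht)).1 h)
    refine ⟨insert s S, ?_, ?_, ?_, ?_, ?_, ?_⟩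
    · rw [Finset.card_insert_of_notMem fun h => hsn (Finset.mem_union_right _ h), hc]
    · exact Finset.forall_mem_insert _ _ _ |>.2 ⟨hs, hS⟩
    · exact Finset.forall_mem_insert _ _ _ |>.2 ⟨hps, hSp⟩
    · exact Finset.forall_mem_insert _ _ _ |>.2 ⟨fun h => hsn (Finset.mem_union_left _ h), hSD⟩
    · intro d hd
      exact Finset.forall_mem_insert _ _ _ |>.2 ⟨hsE d (Finset.mem_union_left _ hd), hDS d hd⟩
    · intro x hx y hy h
      rcases Finset.mem_insert.1 hx with rfl | hx' <;> rcases Finset.mem_insert.1 hy with rfl | hy'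
      · exact hirr _ h
      · exact hsS _ hy' (hsymm _ _ h)
      · exact hsS _ hx' h
      · exact hind _ hx' _ hy' h

/-- Independent sets of a given size, one for each of finitely many ultrafilters, that are generic
over a finite set and homogeneous over each other. -/
theorem exists_homogeneous_family (hsymm : ∀ x y, E x y → E y x) (hirr : ∀ x, ¬ E x x)
    (C : Finset X) (𝒱 : Finset (Ultrafilter X)) (n : ℕ) (W : X → Ultrafilter X)
    (I : Finset X) (hW : ∀ i ∈ I, IsIndepUltrafilter E (W i)) (hV : ∀ i ∈ I, W i ∈ 𝒱) :
    ∃ S : X → Finset X, ∀ i ∈ I, (S i).card = n ∧ (∀ s ∈ S i, s ∉ C) ∧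
      (∀ c ∈ C, ∀ s ∈ S i, (E c s ↔ ∀ᶠ u in (W i : Filter X), E c u)) ∧
      (∀ s ∈ S i, ∀ t ∈ S i, ¬ E s t) ∧
      (∀ V ∈ 𝒱, ∀ s ∈ S i, ((∀ᶠ u in (V : Filter X), E s u) ↔
        ∀ᶠ w in (W i : Filter X), ∀ᶠ u in (V : Filter X), E w u)) ∧
      ∀ j ∈ I, j ≠ i → ∀ s ∈ S i, ∀ s' ∈ S i, ∀ t ∈ S j, (E s t ↔ E s' t) := by
  classical
  induction I using Finset.induction_on with
  | empty => exact ⟨fun _ => ∅, by simp⟩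
  | insert j I hj ih =>
    obtain ⟨S, hS⟩ := ih (fun i hi => hW i (Finset.mem_insert_of_mem hi))
      fun i hi => hV i (Finset.mem_insert_of_mem hi)
    have hp : ∀ᶠ w in (W j : Filter X), ∀ V ∈ 𝒱, ((∀ᶠ u in (V : Filter X), E w u) ↔
        ∀ᶠ w in (W j : Filter X), ∀ᶠ u in (V : Filter X), E w u) := by
      rw [Filter.eventually_all_finset]
      exact fun V _ => (W j).eventually_iff_eventually _
    obtain ⟨R, hRc, hRp, hRD, hDR, hRi⟩ := (hW j (Finset.mem_insert_self _ _)).exists_finset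
      hsymm hirr hp (C ∪ I.biUnion S) n
    have hjV := hV j (Finset.mem_insert_self _ _)
    have hSR : ∀ i ∈ I, ∀ s ∈ S i, ∀ r ∈ R, (E s r ↔ ∀ᶠ u in (W j : Filter X), E s u) :=
      fun i hi s hs r hr =>
        hDR s (Finset.mem_union_right _ (Finset.mem_biUnion.2 ⟨i, hi, hs⟩)) r hr
    refine ⟨Function.update S j R, fun i hi => ?_⟩
    rcases Finset.mem_insert.1 hi with rfl | hi'
    · rw [Function.update_self]
      refine ⟨hRc, fun s hs h => hRD s hs (Finset.mem_union_left _ h),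
        fun c hc => hDR c (Finset.mem_union_left _ hc), hRi, fun V hV s hs => hRp s hs V hV, ?_⟩
      intro k hk hki s hs s' hs' t ht
      have hk := (Finset.mem_insert.1 hk).resolve_left hki
      rw [Function.update_of_ne hki] at ht
      have h1 := hSR k hk t ht s hs
      have h2 := hSR k hk t ht s' hs'
      exact ⟨fun h => hsymm _ _ (h2.2 (h1.1 (hsymm _ _ h))),
        fun h => hsymm _ _ (h1.2 (h2.1 (hsymm _ _ h)))⟩
    · have hij : i ≠ j := fun h => hj (h ▸ hi')
      obtain ⟨h1, h2, h3, h4, h5, h6⟩ := hS i hi'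
      rw [Function.update_of_ne hij]
      refine ⟨h1, h2, h3, h4, h5, ?_⟩
      intro k hk hki s hs s' hs' t ht
      rcases Finset.mem_insert.1 hk with rfl | hk'
      · rw [Function.update_self] at ht
        rw [hSR i hi' s hs t ht, hSR i hi' s' hs' t ht, h5 _ hjV s hs, h5 _ hjV s' hs']
      · have hkj : k ≠ j := fun h => hj (h ▸ hk')
        rw [Function.update_of_ne hkj] at ht
        exact h6 k hk' hki s hs s' hs' t ht

/-- Generic independent sets are classes of mutual twins. Each one added is larger than `C`, while
twins of a point of `C` stay in `C`; so the stabiliser of `B` preserves `C`. The set `R` for `U` is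
so large that some point of it is sent into `R`, which shows that the type `K` is preserved on `C`.
-/
theorem exists_separating_of_indepUltrafilter {G : Type*} [Group G] [MulAction G X]
    (hsymm : ∀ x y, E x y → E y x) (hirr : ∀ x, ¬ E x x)
    (hinv : ∀ (g : G) x y, E (g • x) (g • y) ↔ E x y) (C : Finset X) {a b : X}
    (ha : a ∈ C) {U : Ultrafilter X} (hU : IsIndepUltrafilter E U)
    (hsep : ¬((∀ᶠ u in (U : Filter X), E a u) ↔ ∀ᶠ u in (U : Filter X), E b u))
    (hwit : ∀ c ∈ C, ∃ W : Ultrafilter X, IsIndepUltrafilter E W ∧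
      ¬((∀ᶠ w in (W : Filter X), E c w) ↔
        ∀ᶠ w in (W : Filter X), ∀ᶠ u in (U : Filter X), E w u)) :
    ∃ B : Finset X, C ⊆ B ∧
      ∀ g : G, (∀ c ∈ B, g • c ∈ B) → (∀ c ∈ C, g • c ∈ C) ∧ g • a ≠ b := by
  classical
  have hcomm : ∀ x y, E x y ↔ E y x := fun x y => ⟨hsymm x y, hsymm y x⟩
  have hwit' : ∀ c, ∃ W : Ultrafilter X, c ∈ C → IsIndepUltrafilter E W ∧
      ¬((∀ᶠ w in (W : Filter X), E c w) ↔
        ∀ᶠ w in (W : Filter X), ∀ᶠ u in (U : Filter X), E w u) := fun c => by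
    by_cases hc : c ∈ C
    · obtain ⟨W, hW⟩ := hwit c hc
      exact ⟨W, fun _ => hW⟩
    · exact ⟨U, fun h => absurd h hc⟩
  choose W hW using hwit'
  set K : X → Prop := fun x => ∀ᶠ u in (U : Filter X), E x u with hK
  -- Every `c` must be told from the generic point of `U` by a vertex of `C` or by a set `S i`. A
  -- minimal such `I` is taken: each `i` then has a point `c` that imitates `U` over `C` yet is
  -- exposed by `W i`, and this `c` shows that no point of `S i` is a twin of a point of `C`.
  let P : Finset X → Prop := fun I => ∀ c ∈ C, (∃ v ∈ C, ¬(E v c ↔ K v)) ∨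
    ∃ i ∈ I, ¬((∀ᶠ w in (W i : Filter X), E c w) ↔ ∀ᶠ w in (W i : Filter X), K w)
  have hPC : P C := fun c hc => Or.inr ⟨c, hc, (hW c hc).2⟩
  obtain ⟨I, hIC, hImin⟩ := exists_minimal_le_of_wellFoundedLT P C hPC
  have hI : P I := hImin.prop
  have hcrit : ∀ i ∈ I, ∃ c ∈ C, (∀ v ∈ C, (E v c ↔ K v)) ∧
      ¬((∀ᶠ w in (W i : Filter X), E c w) ↔ ∀ᶠ w in (W i : Filter X), K w) := by
    intro i hi
    have hnot : ¬ P (I.erase i) := fun h =>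
      absurd (hImin.le_of_le h (Finset.erase_subset _ _) hi) (Finset.notMem_erase _ _)
    simp only [P, not_forall] at hnot
    obtain ⟨c, hc, hnot⟩ := hnot
    rw [not_or] at hnot
    have h1 : ∀ v ∈ C, (E v c ↔ K v) := fun v hv => by
      by_contra h
      exact hnot.1 ⟨v, hv, h⟩
    refine ⟨c, hc, h1, ?_⟩
    rcases hI c hc with ⟨v, hv, h⟩ | ⟨j, hj, h⟩
    · exact absurd (h1 v hv) h
    · by_cases hij : j = i
      · exact hij ▸ h
      · exact absurd ⟨j, Finset.mem_erase.2 ⟨hij, hj⟩, h⟩ hnot.2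
  obtain ⟨S, hS⟩ := exists_homogeneous_family hsymm hirr C (insert U (I.image W)) (C.card + 1) W I
    (fun i hi => (hW i (hIC hi)).1)
    fun i hi => Finset.mem_insert_of_mem (Finset.mem_image_of_mem _ hi)
  set D := C ∪ I.biUnion S with hD
  -- Exceeding `C.card` makes the twin class too big for `C`; exceeding `D.card` prevents `R` from
  -- being mapped into `D`.
  obtain ⟨R, hRc, -, hRD, hDR, hRi⟩ := hU.exists_finset hsymm hirr
    (Filter.Eventually.of_forall fun _ => trivial) D (D.card + C.card + 1)
  have hCpos : 0 < C.card := Finset.card_pos.2 ⟨a, ha⟩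
  have hCD : ∀ c ∈ C, c ∈ D := fun c hc => Finset.mem_union_left _ hc
  have hSD : ∀ i ∈ I, ∀ s ∈ S i, s ∈ D := fun i hi s hs =>
    Finset.mem_union_right _ (Finset.mem_biUnion.2 ⟨i, hi, hs⟩)
  have hSU : ∀ i ∈ I, ∀ s ∈ S i, (K s ↔ ∀ᶠ w in (W i : Filter X), K w) := fun i hi s hs =>
    (hS i hi).2.2.2.2.1 U (Finset.mem_insert_self _ _) s hs
  have hSc : ∀ i ∈ I, (S i).card = C.card + 1 := fun i hi => (hS i hi).1
  have hSC : ∀ i ∈ I, ∀ s ∈ S i, s ∉ C := fun i hi => (hS i hi).2.1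
  have hCS : ∀ i ∈ I, ∀ c ∈ C, ∀ s ∈ S i, (E c s ↔ ∀ᶠ w in (W i : Filter X), E c w) :=
    fun i hi => (hS i hi).2.2.1
  have hSi : ∀ i ∈ I, ∀ s ∈ S i, ∀ t ∈ S i, ¬ E s t := fun i hi => (hS i hi).2.2.2.1
  have hSS : ∀ i ∈ I, ∀ j ∈ I, j ≠ i → ∀ s ∈ S i, ∀ s' ∈ S i, ∀ t ∈ S j, (E s t ↔ E s' t) :=
    fun i hi => (hS i hi).2.2.2.2.2
  clear hS
  have hother : ∀ Q : Finset X, 1 < Q.card → ∀ s, ∃ s' ∈ Q, s' ≠ s := fun Q hQ s => by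
    obtain ⟨x, hx, y, hy, hxy⟩ := Finset.one_lt_card.1 hQ
    by_cases h : x = s
    · exact ⟨y, hy, fun h' => hxy (h.trans h'.symm)⟩
    · exact ⟨x, hx, h⟩
  set B := D ∪ R with hB
  have hmem : ∀ x, x ∈ B ↔ x ∈ C ∨ (∃ i ∈ I, x ∈ S i) ∨ x ∈ R := by
    intro x
    simp [hB, hD]
  let tw : X → X → Prop := fun x y => ∀ z ∈ B, z ≠ x → z ≠ y → (E z x ↔ E z y)
  have htwS : ∀ i ∈ I, ∀ s ∈ S i, S i ⊆ B.filter (tw s) := by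
    intro i hi s hs s' hs'
    refine Finset.mem_filter.2 ⟨(hmem _).2 (Or.inr (Or.inl ⟨i, hi, hs'⟩)), fun z hz _ _ => ?_⟩
    rcases (hmem z).1 hz with hz | ⟨j, hj, hz⟩ | hz
    · rw [hCS i hi z hz s hs, hCS i hi z hz s' hs']
    · by_cases hji : j = i
      · subst hji
        exact iff_of_false (hSi j hi z hz s hs) (hSi j hi z hz s' hs')
      · rw [hcomm z s, hcomm z s']
        exact hSS i hi j hj hji s hs s' hs' z hz
    · rw [hcomm z s, hcomm z s', hDR s (hSD i hi s hs) z hz, hDR s' (hSD i hi s' hs') z hz]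
      exact (hSU i hi s hs).trans (hSU i hi s' hs').symm
  have htwR : ∀ s ∈ R, R ⊆ B.filter (tw s) := by
    intro s hs s' hs'
    refine Finset.mem_filter.2 ⟨Finset.mem_union_right _ hs', fun z hz _ _ => ?_⟩
    rcases Finset.mem_union.1 hz with hz | hz
    · rw [hDR z hz s hs, hDR z hz s' hs']
    · exact iff_of_false (hRi z hz s hs) (hRi z hz s' hs')
  obtain ⟨r, hr⟩ : R.Nonempty := Finset.card_pos.1 (by omega)
  have hrne : ∀ x ∈ D, r ≠ x := fun x hx h => hRD r hr (h ▸ hx)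
  have hrE : ∀ x ∈ D, (E r x ↔ K x) := fun x hx => (hcomm r x).trans (hDR x hx r hr)
  have htwC : ∀ e ∈ C, B.filter (tw e) ⊆ C := by
    intro e he s hs
    obtain ⟨hsB, htw⟩ := Finset.mem_filter.1 hs
    clear hs
    rcases (hmem s).1 hsB with hs | ⟨i, hi, hs⟩ | hs
    · exact hs
    · exfalso
      obtain ⟨c, hc, hcU, hcW⟩ := hcrit i hi
      have h1 := htw r (Finset.mem_union_right _ hr) (hrne e (hCD e he))
        (hrne s (hSD i hi s hs))
      rw [hrE e (hCD e he), hrE s (hSD i hi s hs), hSU i hi s hs] at h1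
      have hcs : c ≠ s := fun h => hSC i hi s hs (h ▸ hc)
      by_cases hce : c = e
      · subst hce
        have h2 : ¬ K c := fun h => hirr c ((hcU c hc).2 h)
        obtain ⟨s', hs', hne⟩ := hother (S i) (by rw [hSc i hi]; omega) s
        have h3 := htw s' ((hmem _).2 (Or.inr (Or.inl ⟨i, hi, hs'⟩)))
          (fun h => hSC i hi s' hs' (h ▸ hc)) hne
        rw [hcomm s' c, hCS i hi c hc s' hs'] at h3
        have h4 := hSi i hi s' hs' s hs
        tauto
      · have h2 := htw c ((hmem c).2 (Or.inl hc)) hce hcs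
        rw [hcomm c e, hcU e he, hCS i hi c hc s hs] at h2
        tauto
    · exfalso
      have hsD := hRD s hs
      rcases hI e he with ⟨v, hv, hve⟩ | ⟨i, hi, hie⟩
      · by_cases hev : v = e
        · subst hev
          have hKv : K v := by
            by_contra h
            exact hve (iff_of_false (hirr v) h)
          obtain ⟨s', hs', hne⟩ := hother R (by omega) s
          have h1 := htw s' (Finset.mem_union_right _ hs')
            (fun h => hRD s' hs' (h ▸ hCD v hv)) hne
          exact hRi s' hs' s hs (h1.1 (hsymm _ _ ((hDR v (hCD v hv) s' hs').2 hKv)))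
        · have h1 := htw v ((hmem v).2 (Or.inl hv)) hev fun h => hsD (h ▸ hCD v hv)
          rw [hDR v (hCD v hv) s hs] at h1
          exact hve h1
      · obtain ⟨t, ht⟩ : (S i).Nonempty := Finset.card_pos.1 (by rw [hSc i hi]; omega)
        have h1 := htw t ((hmem _).2 (Or.inr (Or.inl ⟨i, hi, ht⟩)))
          (fun h => hSC i hi t ht (h ▸ he)) (fun h => hsD (h ▸ hSD i hi t ht))
        rw [hcomm t e, hCS i hi e he t ht, hDR t (hSD i hi t ht) s hs] at h1
        exact hie (h1.trans (hSU i hi t ht))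
  refine ⟨B, fun c hc => (hmem c).2 (Or.inl hc), fun g hg => ?_⟩
  have htwg : ∀ x y, tw x y ↔ tw (g • x) (g • y) := by
    intro x y
    constructor
    · intro h z hz hzx hzy
      have := h (g⁻¹ • z) (inv_smul_mem_of_forall_smul_mem hg z hz)
        (fun h' => hzx (by rw [← h', smul_inv_smul])) (fun h' => hzy (by rw [← h', smul_inv_smul]))
      rwa [← hinv g, ← hinv g _ y, smul_inv_smul] at this
    · intro h z hz hzx hzy
      have := h (g • z) (hg z hz) (fun h' => hzx (MulAction.injective g h'))
        (fun h' => hzy (MulAction.injective g h'))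
      rwa [hinv, hinv] at this
  have hgC : ∀ c ∈ C, g • c ∈ C := by
    intro c hc
    have h1 := Finset.card_le_card (htwC c hc)
    rw [card_filter_smul hg (tw c) (tw (g • c)) fun y _ => htwg c y] at h1
    rcases (hmem _).1 (hg c ((hmem c).2 (Or.inl hc))) with h | ⟨i, hi, h⟩ | h
    · exact h
    · have := Finset.card_le_card (htwS i hi _ h)
      rw [hSc i hi] at this
      omega
    · have := Finset.card_le_card (htwR _ h)
      omega
  refine ⟨hgC, fun hab => hsep ?_⟩
  obtain ⟨u, hu, hgu⟩ : ∃ u ∈ R, g • u ∈ R := by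
    by_contra hcon
    push Not at hcon
    have hsub : R.image (g • ·) ⊆ D := by
      intro x hx
      obtain ⟨u, hu, rfl⟩ := Finset.mem_image.1 hx
      exact (Finset.mem_union.1 (hg u (Finset.mem_union_right _ hu))).resolve_right (hcon u hu)
    have := Finset.card_le_card hsub
    rw [Finset.card_image_of_injective _ (MulAction.injective g)] at this
    omega
  have h1 := hDR a (hCD a ha) u hu
  have h2 := hDR (g • a) (hCD _ (hgC a ha)) (g • u) hgu
  rw [hinv, h1, hab] at h2
  exact h2

end BlowUp

/-! ### Weak limits, the obstruction to the blow-up -/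

/-- `c` has the same neighbourhood as the generic point of `U`, up to sets that lie in no
independent ultrafilter. -/
def IsWeakLimit {X : Type*} (E : X → X → Prop) (U : Ultrafilter X) (c : X) : Prop :=
  ∀ W : Ultrafilter X, IsIndepUltrafilter E W →
    ((∀ᶠ w in (W : Filter X), E c w) ↔ ∀ᶠ w in (W : Filter X), ∀ᶠ u in (U : Filter X), E w u)

/-- The weak limits of the independent ultrafilters that separate `x` from `y`. -/
def separatingLimits {X : Type*} (E : X → X → Prop) (x y : X) : Set X :=
  {d | ∃ U : Ultrafilter X, IsIndepUltrafilter E U ∧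
    ¬((∀ᶠ u in (U : Filter X), E x u) ↔ ∀ᶠ u in (U : Filter X), E y u) ∧ IsWeakLimit E U d}

theorem Set.finite_and_ncard_le_of_forall_finset {X : Type*} {s : Set X} {m : ℕ}
    (h : ∀ F : Finset X, (F : Set X) ⊆ s → F.card ≤ m) : s.Finite ∧ s.ncard ≤ m := by
  have hfin : s.Finite := by
    by_contra hinf
    obtain ⟨F, hF, hc⟩ := Set.Infinite.exists_subset_card_eq hinf (m + 1)
    have := h F hF
    omega
  refine ⟨hfin, ?_⟩
  rw [Set.ncard_eq_toFinset_card s hfin]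
  exact h _ (by simp)

section Graph

variable {G X : Type*} [Group G] [MulAction G X] {E : X → X → Prop}

theorem eventually_map_smul_adj_iff (hinv : ∀ (g : G) x y, E (g • x) (g • y) ↔ E x y) (g : G)
    (U : Ultrafilter X) (v : X) :
    (∀ᶠ u in (U.map (g • ·) : Filter X), E v u) ↔ ∀ᶠ u in (U : Filter X), E (g⁻¹ • v) u := by
  rw [Ultrafilter.coe_map, eventually_map]
  refine eventually_congr (Eventually.of_forall fun u => ?_)
  rw [← hinv g (g⁻¹ • v), smul_inv_smul]

theorem IsIndepUltrafilter.map_smul (hinv : ∀ (g : G) x y, E (g • x) (g • y) ↔ E x y)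
    {U : Ultrafilter X} (hU : IsIndepUltrafilter E U) (g : G) :
    IsIndepUltrafilter E (U.map (g • ·)) := by
  refine ⟨?_, ?_⟩
  · rw [Ultrafilter.coe_map]
    exact (Filter.map_mono hU.1).trans (MulAction.injective g).tendsto_cofinite
  · simp only [eventually_map_smul_adj_iff hinv]
    rw [Ultrafilter.coe_map, eventually_map]
    simpa using hU.2

theorem IsWeakLimit.map_smul (hinv : ∀ (g : G) x y, E (g • x) (g • y) ↔ E x y)
    {U : Ultrafilter X} {c : X} (h : IsWeakLimit E U c) (g : G) :
    IsWeakLimit E (U.map (g • ·)) (g • c) := by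
  intro W hW
  have h1 := h _ (hW.map_smul hinv g⁻¹)
  rw [eventually_map_smul_adj_iff hinv, inv_inv, Ultrafilter.coe_map, eventually_map] at h1
  simpa only [eventually_map_smul_adj_iff hinv] using h1

theorem smul_mem_separatingLimits (hinv : ∀ (g : G) x y, E (g • x) (g • y) ↔ E x y) (g : G)
    {x y d : X} (hd : d ∈ separatingLimits E x y) :
    g • d ∈ separatingLimits E (g • x) (g • y) := by
  obtain ⟨U, hU, hs, hl⟩ := hd
  refine ⟨U.map (g • ·), hU.map_smul hinv g, ?_, hl.map_smul hinv g⟩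
  simpa only [eventually_map_smul_adj_iff hinv, inv_smul_smul] using hs

theorem separatingLimits_smul (hinv : ∀ (g : G) x y, E (g • x) (g • y) ↔ E x y) (g : G) (x y : X) :
    separatingLimits E (g • x) (g • y) = (g • ·) '' separatingLimits E x y := by
  ext d
  constructor
  · intro hd
    refine ⟨g⁻¹ • d, ?_, by simp⟩
    simpa using smul_mem_separatingLimits hinv g⁻¹ hd
  · rintro ⟨d, hd, rfl⟩
    exact smul_mem_separatingLimits hinv g hd

theorem separatingLimits_subset_union (x y z : X) :
    separatingLimits E x z ⊆ separatingLimits E x y ∪ separatingLimits E y z := by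
  rintro d ⟨U, hU, hs, hl⟩
  by_cases h : (∀ᶠ u in (U : Filter X), E x u) ↔ ∀ᶠ u in (U : Filter X), E y u
  · exact Or.inr ⟨U, hU, by rwa [h] at hs, hl⟩
  · exact Or.inl ⟨U, hU, h, hl⟩

/-- Translating `U` gives each `v` an independent ultrafilter `Uv v` with weak limit `v`. A uniform
bound would make the rows and columns of `T` uniformly close, hence row `c` finite or cofinite. Then
all independent ultrafilters agree on adjacency to `c`, and by transitivity on adjacency to any
point with the same answer, so `V` could not separate `a` from `b`. -/
theorem not_forall_ncard_separatingLimits_le [MulAction.IsPretransitive G X]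
    (hinv : ∀ (g : G) x y, E (g • x) (g • y) ↔ E x y)
    {U : Ultrafilter X} (hU : IsIndepUltrafilter E U) {c : X} (hl : IsWeakLimit E U c) {a b : X}
    {V : Ultrafilter X} (hV : IsIndepUltrafilter E V)
    (hsep : ¬((∀ᶠ u in (V : Filter X), E a u) ↔ ∀ᶠ u in (V : Filter X), E b u))
    (hfin : ∀ x y, (separatingLimits E x y).Finite) (m : ℕ) :
    ¬ ∀ x y, (separatingLimits E x y).ncard ≤ m := by
  intro hle
  choose γ hγ using fun v : X => MulAction.exists_smul_eq G c v
  set Uv : X → Ultrafilter X := fun v => U.map (γ v • ·) with hUv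
  have hUvI : ∀ v, IsIndepUltrafilter E (Uv v) := fun v => hU.map_smul hinv (γ v)
  have hUvl : ∀ v, IsWeakLimit E (Uv v) v := fun v => by
    have := hl.map_smul hinv (γ v)
    rwa [hγ] at this
  let T : X → X → Prop := fun w y => ∀ᶠ u in (Uv w : Filter X), E y u
  have hT : ∀ y v, {w | ¬(T w y ↔ T v w)}.Finite ∧ {w | ¬(T w y ↔ T v w)}.ncard ≤ m := by
    intro y v
    refine Set.finite_and_ncard_le_of_forall_finset fun F hF => ?_
    have hgen : ∀ᶠ u in (Uv v : Filter X), ∀ w ∈ F, (T w u ↔ T v w) := by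
      rw [Filter.eventually_all_finset]
      intro w _
      have h1 := (Uv v).eventually_iff_eventually fun u => T w u
      rwa [← hUvl w (Uv v) (hUvI v)] at h1
    obtain ⟨u, hu⟩ := hgen.exists
    -- For `u` generic in `Uv v`, the weak limit property turns `T v w` into `T w u`, so a
    -- difference at `w` means that `Uv w` separates `y` from `u`.
    have hsub : (F : Set X) ⊆ separatingLimits E y u := by
      intro w hw
      refine ⟨Uv w, hUvI w, fun h => hF hw ?_, hUvl w⟩
      exact Iff.trans h (hu w hw)
    rw [← Set.ncard_coe_finset]
    exact (Set.ncard_le_ncard hsub (hfin y u)).trans (hle y u)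
  have hconst : ∀ p : Prop, (∀ W : Ultrafilter X, IsIndepUltrafilter E W →
      ((∀ᶠ w in (W : Filter X), E c w) ↔ p)) → False := by
    intro p hp
    have hx : ∀ x, (∀ᶠ u in (V : Filter X), E x u) ↔ p := by
      intro x
      have := hp _ (hV.map_smul hinv (γ x)⁻¹)
      rwa [eventually_map_smul_adj_iff hinv, inv_inv, hγ] at this
    exact hsep ((hx a).trans (hx b).symm)
  rcases finite_or_finite_compl_of_forall_ncard_le T m (fun y v => (hT y v).1)
    (fun y v => (hT y v).2) c with h | h
  · refine hconst False fun W hW => ?_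
    rw [hUvl c W hW, iff_false]
    exact Ultrafilter.eventually_not.1 (hW.1 h.compl_mem_cofinite)
  · refine hconst True fun W hW => ?_
    rw [hUvl c W hW, iff_true]
    filter_upwards [hW.1 h.compl_mem_cofinite] with w hw
    exact not_not.1 hw

/-- The blow-up works for a separating `U` with no weak limit in `C`. Weak limits are unique here,
so such a `U` can fail to exist only if `separatingLimits E a b` is finite and every separating `U`
has a limit. That condition is an invariant equivalence relation; if universal, the number of
separating limits is an unbounded pseudometric. -/
theorem separatesPairs_of_forall_exists_indepUltrafilter [Infinite X]
    [MulAction.IsPreprimitive G X] (hsymm : ∀ x y, E x y → E y x) (hirr : ∀ x, ¬ E x x)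
    (hinv : ∀ (g : G) x y, E (g • x) (g • y) ↔ E x y)
    (hpos : ∀ x y, x ≠ y → ∃ U : Ultrafilter X, IsIndepUltrafilter E U ∧
      ¬((∀ᶠ u in (U : Filter X), E x u) ↔ ∀ᶠ u in (U : Filter X), E y u)) :
    SeparatesPairs G X := by
  have huniq : ∀ U c d, IsWeakLimit E U c → IsWeakLimit E U d → c = d := by
    intro U c d hc hd
    by_contra hne
    obtain ⟨W, hW, hs⟩ := hpos c d hne
    exact hs ((hc W hW).trans (hd W hW).symm)
  have hself : ∀ x, separatingLimits E x x = ∅ := fun x =>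
    Set.eq_empty_of_forall_notMem fun d ⟨U, _, hs, _⟩ => hs Iff.rfl
  have hcomm : ∀ x y, separatingLimits E x y = separatingLimits E y x := by
    intro x y
    ext d
    simp only [separatingLimits, Set.mem_ofPred_eq,
      @iff_comm (∀ᶠ u in _, E x u) (∀ᶠ u in _, E y u)]
  let r : X → X → Prop := fun x y => (separatingLimits E x y).Finite ∧
    ∀ U : Ultrafilter X, IsIndepUltrafilter E U →
      ¬((∀ᶠ u in (U : Filter X), E x u) ↔ ∀ᶠ u in (U : Filter X), E y u) → ∃ d, IsWeakLimit E U d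
  have hr : Equivalence r := by
    refine ⟨fun x => ⟨by simp [hself], fun U _ h => absurd Iff.rfl h⟩,
      fun {x y} h => ⟨hcomm x y ▸ h.1, fun U hU hs => h.2 U hU fun h' => hs h'.symm⟩,
      fun {x y z} h1 h2 => ⟨(h1.1.union h2.1).subset (separatingLimits_subset_union x y z),
        fun U hU hs => ?_⟩⟩
    by_cases h : (∀ᶠ u in (U : Filter X), E x u) ↔ ∀ᶠ u in (U : Filter X), E y u
    · exact h2.2 U hU (by rwa [h] at hs)
    · exact h1.2 U hU h
  have hri : ∀ (g : G) x y, r x y → r (g • x) (g • y) := by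
    intro g x y h
    refine ⟨by rw [separatingLimits_smul hinv]; exact h.1.image _, fun U hU hs => ?_⟩
    obtain ⟨d, hd⟩ := h.2 _ (hU.map_smul hinv g⁻¹) (by
      simpa only [eventually_map_smul_adj_iff hinv, inv_inv] using hs)
    refine ⟨g • d, ?_⟩
    have := hd.map_smul hinv g
    rwa [Ultrafilter.map_map, show ((g • ·) ∘ (g⁻¹ • ·) : X → X) = id by ext x; simp,
      Ultrafilter.map_id] at this
  rcases eq_or_forall_of_isPreprimitive hr hri with h | h
  · intro C a b ha hb hab
    obtain ⟨U, hU, hs, hlim⟩ : ∃ U : Ultrafilter X, IsIndepUltrafilter E U ∧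
        ¬((∀ᶠ u in (U : Filter X), E a u) ↔ ∀ᶠ u in (U : Filter X), E b u) ∧
        ∀ c ∈ C, ¬ IsWeakLimit E U c := by
      by_cases hF : (separatingLimits E a b).Finite
      · by_contra hcon
        refine hab (h a b ⟨hF, fun U hU hs => ?_⟩)
        by_contra hnone
        exact hcon ⟨U, hU, hs, fun c _ hc => hnone ⟨c, hc⟩⟩
      · obtain ⟨d, ⟨U, hU, hs, hd⟩, hdC⟩ := Set.Infinite.exists_notMem_finset hF C
        exact ⟨U, hU, hs, fun c hc hl => hdC (huniq U c d hl hd ▸ hc)⟩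
    refine exists_separating_of_indepUltrafilter hsymm hirr hinv C ha hU hs fun c hc => ?_
    have := hlim c hc
    simp only [IsWeakLimit, not_forall] at this
    obtain ⟨W, hW, hne⟩ := this
    exact ⟨W, hW, hne⟩
  · refine separatesPairs_of_unbounded (fun x y => (separatingLimits E x y).ncard)
      (fun x => by simp [hself]) (fun x y z => ?_) (fun g x y => ?_) fun m => ?_
    · exact (Set.ncard_le_ncard (separatingLimits_subset_union x y z)
        ((h x y).1.union (h y z).1)).trans (Set.ncard_union_le _ _)
    · simp only [separatingLimits_smul hinv]
      exact Set.ncard_image_of_injective _ (MulAction.injective g)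
    · obtain ⟨a, b, hab⟩ := exists_pair_ne X
      obtain ⟨U, hU, hs⟩ := hpos a b hab
      obtain ⟨c, hc⟩ := (h a b).2 U hU hs
      by_contra hcon
      exact not_forall_ncard_separatingLimits_le hinv hU hc hU hs (fun x y => (h x y).1) m
        fun x y => not_lt.1 fun hlt => hcon ⟨x, y, hlt⟩

/-! ### The graph case and the choice of an orbital -/

/-- If independent ultrafilters separate points for the graph or for its complement, the blow-up
argument applies. Otherwise neither kind separates any points. Every nonprincipal ultrafilter is of
one of the two kinds, so any two neighbourhoods differ finitely, and a pseudometric from symmetric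
differences or from a locally finite graph remains. -/
theorem separatesPairs_of_graph [Infinite X] [MulAction.IsPreprimitive G X]
    (hsymm : ∀ x y, E x y → E y x) (hirr : ∀ x, ¬ E x x)
    (hinv : ∀ (g : G) x y, E (g • x) (g • y) ↔ E x y) (hedge : ∃ x y, E x y)
    (hnonedge : ∃ x y, x ≠ y ∧ ¬ E x y) : SeparatesPairs G X := by
  have dich : ∀ F : X → X → Prop, (∀ (g : G) x y, F (g • x) (g • y) ↔ F x y) →
      (∀ x y, x ≠ y → ∃ U : Ultrafilter X, IsIndepUltrafilter F U ∧
        ¬((∀ᶠ u in (U : Filter X), F x u) ↔ ∀ᶠ u in (U : Filter X), F y u)) ∨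
      ∀ x y (U : Ultrafilter X), IsIndepUltrafilter F U →
        ((∀ᶠ u in (U : Filter X), F x u) ↔ ∀ᶠ u in (U : Filter X), F y u) := by
    intro F hF
    rcases eq_or_forall_of_isPreprimitive (G := G) (r := fun x y => ∀ U : Ultrafilter X,
      IsIndepUltrafilter F U → ((∀ᶠ u in (U : Filter X), F x u) ↔ ∀ᶠ u in (U : Filter X), F y u))
      ⟨fun _ _ _ => Iff.rfl, fun h U hU => (h U hU).symm, fun h1 h2 U hU => (h1 U hU).trans (h2 U hU)⟩
      (fun g x y h U hU => by
        simpa only [eventually_map_smul_adj_iff hF, inv_inv] using h _ (hU.map_smul hF g⁻¹))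
      with h | h
    · left
      intro x y hxy
      by_contra hcon
      refine hxy (h x y fun U hU => ?_)
      by_contra hs
      exact hcon ⟨U, hU, hs⟩
    · exact Or.inr h
  let E' : X → X → Prop := fun x y => x ≠ y ∧ ¬ E x y
  have hinv' : ∀ (g : G) x y, E' (g • x) (g • y) ↔ E' x y := fun g x y => by
    simp only [E', hinv, ne_eq, smul_left_cancel_iff]
  have hsymm' : ∀ x y, E' x y → E' y x := fun x y h => ⟨h.1.symm, fun h' => h.2 (hsymm _ _ h')⟩
  have hirr' : ∀ x, ¬ E' x x := fun x h => h.1 rfl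
  rcases dich E hinv with h | hE
  · exact separatesPairs_of_forall_exists_indepUltrafilter hsymm hirr hinv h
  rcases dich E' hinv' with h | hE'
  · exact separatesPairs_of_forall_exists_indepUltrafilter hsymm' hirr' hinv' h
  have hfin : ∀ x y, {w | ¬(E x w ↔ E y w)}.Finite := by
    intro x y
    by_contra hinf
    obtain ⟨U, hU, hUs⟩ := Set.Infinite.exists_ultrafilter hinf
    have hsep := U.not_iff_of_eventually_not_iff hUs
    have hcompl : ∀ v, (∀ᶠ u in (U : Filter X), E' v u) ↔ ¬ ∀ᶠ u in (U : Filter X), E v u := by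
      intro v
      rw [← Ultrafilter.eventually_not]
      have hne : ∀ᶠ t in (U : Filter X), t ≠ v := hU (Set.finite_singleton v).compl_mem_cofinite
      exact eventually_congr (hne.mono fun t ht => and_iff_right ht.symm)
    by_cases hind : ∀ᶠ s in (U : Filter X), ¬ ∀ᶠ t in (U : Filter X), E s t
    · exact hsep (hE x y U ⟨hU, hind⟩)
    · have h1 := hE' x y U ⟨hU, by
        simp only [hcompl]
        exact Ultrafilter.eventually_not.2 hind⟩
      rw [hcompl, hcompl] at h1
      exact hsep (not_iff_not.1 h1)
  by_cases hunb : ∀ m, ∃ x y, m < {w | ¬(E x w ↔ E y w)}.ncard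
  · exact separatesPairs_of_ncard_unbounded E hinv hfin hunb
  rw [not_forall] at hunb
  obtain ⟨m, hm⟩ := hunb
  have hm' : ∀ x y, {w | ¬(E x w ↔ E y w)}.ncard ≤ m := fun x y =>
    not_lt.1 fun hlt => hm ⟨x, y, hlt⟩
  have hcomm : ∀ x y, E x y ↔ E y x := fun x y => ⟨hsymm x y, hsymm y x⟩
  have hset : ∀ y v, {w | ¬(E w y ↔ E v w)} = {w | ¬(E y w ↔ E v w)} := fun y v => by
    ext w
    rw [Set.mem_ofPred_eq, Set.mem_ofPred_eq, hcomm w y]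
  obtain ⟨v⟩ : Nonempty X := inferInstance
  rcases finite_or_finite_compl_of_forall_ncard_le E m (fun y v => hset y v ▸ hfin y v)
    (fun y v => hset y v ▸ hm' y v) v with h | h
  · refine separatesPairs_of_locallyFinite E hsymm hirr hinv hedge fun x => ?_
    refine (h.union (hfin x v)).subset fun w hw => ?_
    by_cases hvw : E v w
    · exact Or.inl hvw
    · exact Or.inr fun h' => hvw (h'.1 hw)
  · refine separatesPairs_of_locallyFinite E' hsymm' hirr' hinv' hnonedge fun x => ?_
    refine (h.union (hfin x v)).subset fun w hw => ?_
    by_cases hvw : E v w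
    · exact Or.inr fun h' => hw.2 (h'.2 hvw)
    · exact Or.inl hvw

theorem separatesPairs_of_not_isMultiplyPretransitive [Infinite X] [MulAction.IsPreprimitive G X]
    (h : ¬ MulAction.IsMultiplyPretransitive G X 2) : SeparatesPairs G X := by
  rw [MulAction.is_two_pretransitive_iff] at h
  push Not at h
  obtain ⟨a, b, c, d, hab, hcd, hno⟩ := h
  let O : X → X → Prop := fun x y => ∃ g : G, g • a = x ∧ g • b = y
  have hO : ∀ (g : G) x y, O (g • x) (g • y) ↔ O x y := by
    have hO' : ∀ (g : G) x y, O x y → O (g • x) (g • y) := by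
      rintro g x y ⟨k, rfl, rfl⟩
      exact ⟨g * k, mul_smul _ _ _, mul_smul _ _ _⟩
    exact fun g x y => ⟨fun h => by simpa using hO' g⁻¹ _ _ h, hO' g x y⟩
  have hOirr : ∀ x, ¬ O x x := by
    rintro x ⟨g, h1, h2⟩
    exact hab (MulAction.injective g (h1.trans h2.symm))
  have hOab : O a b := ⟨1, one_smul _ _, one_smul _ _⟩
  have hOcd : ¬ O c d := fun ⟨g, h1, h2⟩ => hno g h1 h2
  by_cases hall : ∀ x y, x ≠ y → O x y ∨ O y x
  · refine separatesPairs_of_tournament O hO (fun x y hxy => ⟨fun hxy' hyx' => ?_, fun hn => ?_⟩) hOirr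
    · obtain ⟨g, rfl, rfl⟩ := hxy'
      have hba : O b a := (hO g b a).1 hyx'
      have hO_symm : ∀ u v, O u v → O v u := by
        rintro u v ⟨k, rfl, rfl⟩
        exact (hO k b a).2 hba
      rcases hall c d hcd with h | h
      · exact hOcd h
      · exact hOcd (hO_symm _ _ h)
    · exact (hall x y hxy).resolve_right hn
  · push Not at hall
    obtain ⟨x, y, hxy, h1, h2⟩ := hall
    exact separatesPairs_of_graph (E := fun x y => O x y ∨ O y x) (fun _ _ h => h.symm)
      (fun x h => hOirr x (h.elim id id)) (fun g x y => by rw [hO, hO]) ⟨a, b, Or.inl hOab⟩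
      ⟨x, y, hxy, not_or.2 ⟨h1, h2⟩⟩

end Graph

/-! ### From finite rigidity to equality of closed groups -/

open Classical Pointwise in
theorem eq_of_finitelyRigid {X : Type*} {G H : Subgroup (Equiv.Perm X)}
    (hH : IsClosedPermGroup H) (hHG : H ≤ G) (horb : OrbitEquivalent G H)
    (hrig : FinitelyRigid G X) : H = G := by
  refine le_antisymm hHG fun g hg => ?_
  let _ : TopologicalSpace X := ⊥
  have : DiscreteTopology X := ⟨rfl⟩
  let _ : TopologicalSpace (Equiv.Perm X) := permPointwiseTopology X
  have hcl : IsClosed (H : Set (Equiv.Perm X)) := hH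
  have hind : Topology.IsInducing (fun (g : Equiv.Perm X) (x : X) => g x) := ⟨rfl⟩
  have hmem : g ∈ closure (H : Set (Equiv.Perm X)) := by
    rw [hind.closure_eq_preimage_closure_image, Set.mem_preimage, mem_closure_iff_nhds]
    intro t ht
    rw [nhds_pi, Filter.mem_pi] at ht
    obtain ⟨I, hI, t', ht', hsub⟩ := ht
    suffices h : ∃ h ∈ H, ∀ x ∈ I, h x = g x by
      obtain ⟨h, hh, hhx⟩ := h
      refine ⟨fun x => h x, hsub fun x hx => ?_, h, hh, rfl⟩
      rw [hhx x hx]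
      exact mem_of_mem_nhds (ht' x)
    obtain ⟨B, hB⟩ := hrig hI.toFinset
    -- Orbit equivalence says nothing for `k = 0`; but if `B` is empty, every element of `G` fixes
    -- `I` pointwise and the identity serves.
    rcases B.eq_empty_or_nonempty with rfl | hne
    · refine ⟨1, H.one_mem, fun x hx => ?_⟩
      exact (hB ⟨g, hg⟩ (by simp) x (hI.mem_toFinset.2 hx)).symm
    · have h1 := horb B.card hne.card_pos ⟨B, rfl⟩
      have h2 : (⟨g, hg⟩ : G) • (⟨B, rfl⟩ : Set.powersetCard X B.card) ∈
          MulAction.orbit H (⟨B, rfl⟩ : Set.powersetCard X B.card) := by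
        rw [← h1]
        exact MulAction.mem_orbit _ _
      obtain ⟨h, hh⟩ := h2
      have h3 : (h : H) • B = (⟨g, hg⟩ : G) • B := congrArg Subtype.val hh
      refine ⟨h, h.2, fun x hx => ?_⟩
      have h4 := hB ((⟨h.1, hHG h.2⟩ : G)⁻¹ * ⟨g, hg⟩) (fun b hb => ?_) x (hI.mem_toFinset.2 hx)
      · have h5 : (h.1)⁻¹ (g x) = x := h4
        rw [Equiv.Perm.inv_eq_iff_eq] at h5
        exact h5.symm
      · have h5 : (⟨g, hg⟩ : G) • b ∈ (h : H) • B := by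
          rw [h3]
          exact Finset.smul_mem_smul_finset hb
        obtain ⟨y, hy, hyb⟩ := Finset.mem_smul_finset.1 h5
        have h6 : h.1 y = g b := hyb
        have h7 : (h.1)⁻¹ (g b) = y := by rw [Equiv.Perm.inv_eq_iff_eq, h6]
        have h8 : ((⟨h.1, hHG h.2⟩ : G)⁻¹ * ⟨g, hg⟩) • b = y := h7
        rwa [h8]
  rwa [hcl.closure_eq] at hmem

theorem theorem1p1 {X : Type*} [Infinite X] (G H : Subgroup (Equiv.Perm X))
    (hG : IsClosedPermGroup G) (hH : IsClosedPermGroup H) (hHG : H ≤ G)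
    (horb : OrbitEquivalent G H)
    (hprim : MulAction.IsPreprimitive G X)
    (hnot : ¬ MulAction.IsMultiplyPretransitive G X 2) :
    H = G :=
  eq_of_finitelyRigid hH hHG horb
    (separatesPairs_of_not_isMultiplyPretransitive hnot).finitelyRigid
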